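/- Let $(\Omega,\mathscr F,\mu)$ be a probability space and let $(\mathcal E,\mathcal D(\mathcal E))$ be a symmetric Dirichlet form on $L^2(\mu)$ (a densely defined, closed, nonnegative symmetric bilinear form on which the unit contraction $f\mapsto (f\vee 0)\wedge 1$ operates) such that $1\in\mathcal D(\mathcal E)$ and $\mathcal E(f,1)=0$ for all $f\in\mathcal D(\mathcal E)$. Write $\mu(f)=\int_\Omega f\,d\mu$ and $\mathrm{Ent}_\mu(f^2)=\mu(f^2\log f^2)-\mu(f^2)\log\mu(f^2)$. A rate function is a non-increasing function $\beta:(0,\infty)\to[0,\infty)$. The super-Poincaré inequality (SPI) with rate function $\beta$ is $$\mu(f^2)\le s\,\mathcal E(f,f)+\beta(s)\,\mu(|f|)^2,\qquad s>0,\ f\in\mathcal D(\mathcal E),$$ and the super log-Sobolev inequality (SLSI) with rate function $\beta$ is $$\mathrm{Ent}_\mu(f^2)\le s\,\mathcal E(f,f)+\beta(s)\,\mu(f^2),\qquad s>0,\ f\in\mathcal D(\mathcal E),$$ which includes that $f^2\log f^2$ is $\mu$-integrable. With the convention $\inf\emptyset=-\infty$, put $$\xi_1(t)=\inf\Big\{\frac{r}{1-t\beta_{\rm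 SP}(r)}:\ r>0,\ 1-t\beta_{\rm SP}(r)>0\Big\},\qquad \xi_2(t)=\inf\Big\{\frac{r}{t-\beta_{\rm SL}(r)}:\ r>0,\ t-\beta_{\rm SL}(r)>0\Big\}.$$ **Theorem 1.2.** (1) Suppose that the SPI holds with rate function $\beta_{\rm SP}$, and let $\delta>2$ be such that $\lim_{n\to\infty}n\,\xi_1(\delta^{-n+1})=0$. Then there are constants $C_4>0$, $s_0>0$ and an integer $n_0\ge2$ such that, for every $s\in(0,s_0]$, the set $\{n\ge n_0:\ C_4\,n\,\xi_1(\delta^{-n+1})>s\}$ is bounded and, with $$N_0(s)=\sup\{n\ge n_0:\ C_4\,n\,\xi_1(\delta^{-n+1})>s\}$$ (where $N_0(s)=n_0$ if this set is empty), the SLSI holds with rate function $\beta_{\rm SL}(s)=(\log\delta)(1+N_0(s))$ for $s\in(0,s_0]$ and $\beta_{\rm SL}(s)=\beta_{\rm SL}(s_0)$ for $s>s_0$. (2) Suppose that the SLSI holds with rate function $\beta_{\rm SL}$, and let $\delta>2$. Then there are constants $C_5,C_6>0$ and an integer $n_0\ge2$ such that, for every $s>0$, the set $\{k\ge n_0:\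 \xi_2(k\log\delta)\le C_6s\}$ is non-empty, and the SPI holds with rate function $$\beta_{\rm SP}(s)=C_5\inf\{\delta^k:\ k\ge n_0,\ \xi_2(k\log\delta)\le C_6s\},\qquad s>0.$$ -/

import Mathlib

open MeasureTheory Filter Topology Set

noncomputable section

/-- A symmetric Dirichlet form on `L²(μ)`: a densely defined, symmetric, nonnegative, closed
bilinear form on which the unit contraction `u ↦ (u ∨ 0) ∧ 1` operates. -/
structure DirichletForm {Ω : Type*} [MeasurableSpace Ω] (μ : Measure Ω) where
  /-- The domain, a linear subspace of `L²(μ)`. -/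
  domain : Submodule ℝ (Lp ℝ 2 μ)
  dense_domain : Dense (domain : Set (Lp ℝ 2 μ))
  /-- The bilinear form on the domain. -/
  form : domain →ₗ[ℝ] domain →ₗ[ℝ] ℝ
  symm : ∀ u v : domain, form u v = form v u
  nonneg : ∀ u : domain, 0 ≤ form u u
  /-- Closedness: the domain is complete for the norm `(form u u + ‖u‖²)^(1/2)`. -/
  closed : ∀ u : ℕ → domain,
    (∀ ε : ℝ, 0 < ε → ∃ N : ℕ, ∀ m ≥ N, ∀ n ≥ N,
      form (u m - u n) (u m - u n) + ‖u m - u n‖ ^ 2 < ε) →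
    ∃ v : domain,
      Tendsto (fun n => form (u n - v) (u n - v) + ‖u n - v‖ ^ 2) atTop (𝓝 0)
  /-- The Markov property. -/
  markov : ∀ u : domain, ∃ v : domain,
    ((v : Lp ℝ 2 μ) : Ω → ℝ) =ᵐ[μ] (fun x => min (max (((u : Lp ℝ 2 μ) : Ω → ℝ) x) 0) 1) ∧
      form v v ≤ form u u

namespace DirichletForm

variable {Ω : Type*} [MeasurableSpace Ω] {μ : Measure Ω}

/-- The constant function `1` is in the domain and `form f 1 = 0` for every `f` in the domain. -/
def Conservative (E : DirichletForm μ) : Prop :=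
  ∃ e : E.domain, ((e : Lp ℝ 2 μ) : Ω → ℝ) =ᵐ[μ] (fun _ => (1 : ℝ)) ∧
    ∀ f : E.domain, E.form f e = 0

end DirichletForm

/-- `Ent_μ(f²) = μ(f² log f²) - μ(f²) log μ(f²)`, with `0 log 0 = 0`. -/
def entropySq {Ω : Type*} [MeasurableSpace Ω] (μ : Measure Ω) (f : Ω → ℝ) : ℝ :=
  (∫ x, f x ^ 2 * Real.log (f x ^ 2) ∂μ) -
    (∫ x, f x ^ 2 ∂μ) * Real.log (∫ x, f x ^ 2 ∂μ)

/-- Rate functions: nonnegative, non-increasing functions on `(0, ∞)`; values at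
arguments `s ≤ 0` play no role. -/
def IsRateFunction (β : ℝ → ℝ) : Prop :=
  AntitoneOn β (Ioi 0) ∧ ∀ s : ℝ, 0 < s → 0 ≤ β s

/-- The super-Poincaré inequality with rate function `β`. -/
def SuperPoincare {Ω : Type*} [MeasurableSpace Ω] {μ : Measure Ω} (E : DirichletForm μ)
    (β : ℝ → ℝ) : Prop :=
  IsRateFunction β ∧ ∀ s : ℝ, 0 < s → ∀ f : E.domain,
    ∫ x, ((f : Lp ℝ 2 μ) : Ω → ℝ) x ^ 2 ∂μ ≤
      s * E.form f f + β s * (∫ x, |((f : Lp ℝ 2 μ) : Ω → ℝ) x| ∂μ) ^ 2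

/-- The super log-Sobolev inequality with rate function `β`. As `f² log f²` is bounded below,
`Ent_μ(f²)` is always defined in `(-∞, +∞]`; the inequality includes that it is finite, that is,
that `f² log f²` is integrable. -/
def SuperLogSobolev {Ω : Type*} [MeasurableSpace Ω] {μ : Measure Ω} (E : DirichletForm μ)
    (β : ℝ → ℝ) : Prop :=
  IsRateFunction β ∧ ∀ s : ℝ, 0 < s → ∀ f : E.domain,
    Integrable (fun x => ((f : Lp ℝ 2 μ) : Ω → ℝ) x ^ 2 *
      Real.log (((f : Lp ℝ 2 μ) : Ω → ℝ) x ^ 2)) μ ∧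
    entropySq μ ((f : Lp ℝ 2 μ) : Ω → ℝ) ≤
      s * E.form f f + β s * ∫ x, ((f : Lp ℝ 2 μ) : Ω → ℝ) x ^ 2 ∂μ

open Classical in
/-- Infimum of a set of nonnegative reals, with the convention `inf ∅ = -∞`. -/
def infBot (S : Set ℝ) : EReal := if S.Nonempty then ((sInf S : ℝ) : EReal) else ⊥

/-- `ξ₁(t) = inf {r / (1 - t β(r)) : r > 0, 1 - t β(r) > 0}`. -/
def xi1 (β : ℝ → ℝ) (t : ℝ) : EReal :=
  infBot {y : ℝ | ∃ r : ℝ, 0 < r ∧ 0 < 1 - t * β r ∧ y = r / (1 - t * β r)}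

/-- `ξ₂(t) = inf {r / (t - β(r)) : r > 0, t - β(r) > 0}`. -/
def xi2 (β : ℝ → ℝ) (t : ℝ) : EReal :=
  infBot {y : ℝ | ∃ r : ℝ, 0 < r ∧ 0 < t - β r ∧ y = r / (t - β r)}

/-- `{n ≥ n₀ : C n ξ₁(δ^(-n+1)) > s}`. -/
def levelSet (β : ℝ → ℝ) (δ C : ℝ) (n₀ : ℕ) (s : ℝ) : Set ℕ :=
  {n : ℕ | n₀ ≤ n ∧ (s : EReal) < ((C * n : ℝ) : EReal) * xi1 β (δ ^ (-(n : ℤ) + 1))}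

/-- `N₀(s) = sup {n ≥ n₀ : C n ξ₁(δ^(-n+1)) > s}`, the supremum being taken in
`{n₀, n₀ + 1, …}`, so that it is `n₀` if there is no such `n`. -/
def bigN0 (β : ℝ → ℝ) (δ C : ℝ) (n₀ : ℕ) (s : ℝ) : ℕ :=
  sSup (insert n₀ (levelSet β δ C n₀ s))

/-- `(log δ) (1 + N₀(s))` for `s ≤ s₀`, continued by its value at `s₀` for `s > s₀`. -/
def rateSL (β : ℝ → ℝ) (δ C s₀ : ℝ) (n₀ : ℕ) (s : ℝ) : ℝ :=
  if s ≤ s₀ then Real.log δ * (1 + (bigN0 β δ C n₀ s : ℝ))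
  else Real.log δ * (1 + (bigN0 β δ C n₀ s₀ : ℝ))

/-- `{δ^k : k ≥ n₀, ξ₂(k log δ) ≤ C s}`. -/
def powerSet (β : ℝ → ℝ) (δ C : ℝ) (n₀ : ℕ) (s : ℝ) : Set ℝ :=
  {y : ℝ | ∃ k : ℕ, n₀ ≤ k ∧ xi2 β (k * Real.log δ) ≤ ((C * s : ℝ) : EReal) ∧ y = δ ^ k}

/-- `C₅ inf {δ^k : k ≥ n₀, ξ₂(k log δ) ≤ C₆ s}`. -/
def rateSP (β : ℝ → ℝ) (δ C₅ C₆ : ℝ) (n₀ : ℕ) (s : ℝ) : ℝ :=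
  C₅ * sInf (powerSet β δ C₆ n₀ s)

end

/-! Both directions cut `f` and `-f` horizontally into slices, the part of the graph between two
heights. Since constants carry no energy, the Markov property bounds the energy of a slice by that
of `f`. More is true: a slice and the remainder have nonnegative mutual energy, so the energies of
consecutive slices sum to at most `E.form f f` (`exists_slices`).

From SPI to SLSI: normalize `∫ f² = 1` and put `q = √δ`. The slice from `q ^ j` to `q ^ (j + 1)`
lives on `{f > q ^ j}`, of measure at most `δ ^ (-j)`. By Cauchy–Schwarz the L¹ term of the SPI is
then absorbed, so the squared L² norm of the slice is at most `xi1 β (δ ^ (-j))` times its energy.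
Pointwise, `f² log f²` is at most `(log δ)(N + 1) f²` plus squares of the slices with `j ≥ N`,
weighted by multiples of `j + 2` (`sq_mul_log_sq_le`). For `N = N₀(s)` each weight times `xi1` is
small enough, and summing energies gives the SLSI.

From SLSI to SPI: one slice `g` above height `R ∫ |f|` suffices. It lives on a set of measure at
most `1 / R`, which forces `Ent(g²) ≥ (log R) ∫ g²`. The SLSI then bounds `∫ g²` by `xi2 β (log R)`
times the energy. The part of `f` below that height contributes the L¹ term. Finally `R = δ ^ k`. -/

/-- The slice of `y` between heights `a` and `a + d`, shifted to start at `0`. -/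
def slice (a d y : ℝ) : ℝ := min (max (y - a) 0) d

/-! ### Pointwise identities for slices. -/

lemma slice_nonneg (a y : ℝ) {d : ℝ} (hd : 0 ≤ d) : 0 ≤ slice a d y :=
  le_min (le_max_right _ _) hd

lemma slice_eq_zero {a d y : ℝ} (hd : 0 ≤ d) (h : y ≤ a) : slice a d y = 0 := by
  rw [slice, max_eq_right (by linarith), min_eq_left hd]

lemma slice_eq_width {a d y : ℝ} (hd : 0 ≤ d) (h : a + d ≤ y) : slice a d y = d := by
  rw [slice, max_eq_left (by linarith), min_eq_right (by linarith)]

lemma slice_eq_sub {a d y : ℝ} (h : a ≤ y) (h' : y ≤ a + d) : slice a d y = y - a := by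
  rw [slice, max_eq_left (by linarith), min_eq_left (by linarith)]

/-- The remainder `y - slice 0 d y` is negative only where the slice is `0`, and positive only where
it is already full. This one-sided stability drives the sign of the cross energy in `exists_slice`.
-/
lemma slice_slice_add_mul (d y t : ℝ) (hd : 0 ≤ d) (ht : 0 ≤ t) :
    slice 0 d (slice 0 d y + t * (y - slice 0 d y)) = slice 0 d y := by
  rcases le_total y 0 with h | h
  · rw [slice_eq_zero hd h]
    exact slice_eq_zero hd (by nlinarith)
  rcases le_total y d with h' | h'
  · rw [slice_eq_sub h (by linarith)]
    rw [slice_eq_sub] <;> linarith [h, h']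
  · have e : slice 0 d y = d := slice_eq_width hd (by linarith)
    rw [e]
    exact slice_eq_width hd (by nlinarith)

lemma sum_range_slice {a : ℕ → ℝ} (ha : Monotone a) (y : ℝ) (K : ℕ) :
    ∑ k ∈ Finset.range K, slice (a k) (a (k + 1) - a k) y = slice (a 0) (a K - a 0) y := by
  induction K with
  | zero => simp [slice]
  | succ K ih =>
    rw [Finset.sum_range_succ, ih]
    have h1 := ha (Nat.zero_le K)
    have h2 := ha (Nat.le_succ K)
    simp only [Nat.succ_eq_add_one] at h2
    rcases le_total y (a K) with h | h
    · rw [slice_eq_zero (a := a K) (by linarith) h, add_zero]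
      rcases le_total y (a 0) with h' | h'
      · rw [slice_eq_zero (by linarith) h', slice_eq_zero (by linarith) h']
      · rw [slice_eq_sub h' (by linarith), slice_eq_sub h' (by linarith)]
    · rw [slice_eq_width (a := a 0) (y := y) (by linarith) (by linarith)]
      rcases le_total y (a (K + 1)) with h' | h'
      · rw [slice_eq_sub h (by linarith), slice_eq_sub (by linarith) (by linarith)]
        ring
      · rw [slice_eq_width (by linarith) (by linarith), slice_eq_width (by linarith) (by linarith)]
        ring

/-- Removing a layer lowers everything above it, so the next slice starts again at `a₀`. Thus each
slice is the bottom slice of the remainder, which permits induction. -/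
lemma slice_sub_slice {a₀ a₁ a₂ : ℝ} (h₀ : a₀ ≤ a₁) (h₁ : a₁ ≤ a₂) (y : ℝ) :
    slice a₀ (a₂ - a₁) (y - slice a₀ (a₁ - a₀) y) = slice a₁ (a₂ - a₁) y := by
  rcases le_total y a₀ with h | h
  · rw [slice_eq_zero (by linarith) h, slice_eq_zero (by linarith) (by linarith),
      slice_eq_zero (by linarith) (by linarith)]
  rcases le_total y a₁ with h' | h'
  · rw [slice_eq_sub h (by linarith), slice_eq_zero (by linarith) (by linarith),
      slice_eq_zero (by linarith) (by linarith)]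
  · have e : slice a₀ (a₁ - a₀) y = a₁ - a₀ := slice_eq_width (by linarith) (by linarith)
    rw [e, slice, slice]
    congr 2
    ring

/-! ### Energy of slices. -/

namespace DirichletForm

variable {Ω : Type*} [MeasurableSpace Ω] {μ : Measure Ω}

/-- Slicing operates on a conservative Dirichlet form. -/
lemma exists_slice_form_le {E : DirichletForm μ} (hE : E.Conservative) (u : E.domain) (a : ℝ)
    {d : ℝ} (hd : 0 < d) :
    ∃ v : E.domain, ((v : Lp ℝ 2 μ) : Ω → ℝ) =ᵐ[μ] (fun x => slice a d ((u : Lp ℝ 2 μ) x)) ∧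
      E.form v v ≤ E.form u u := by
  obtain ⟨e, he1, he⟩ := hE
  -- The slice is `d` times the unit contraction of `(u - a) / d`.
  obtain ⟨v, hv, hvE⟩ := E.markov (d⁻¹ • (u - a • e))
  refine ⟨d • v, ?_, ?_⟩
  · have h1 : ((d • v : E.domain) : Lp ℝ 2 μ) = d • (v : Lp ℝ 2 μ) := rfl
    have h2 : ((d⁻¹ • (u - a • e) : E.domain) : Lp ℝ 2 μ)
      = d⁻¹ • ((u : Lp ℝ 2 μ) - a • (e : Lp ℝ 2 μ)) := rfl
    rw [h2] at hv
    rw [h1]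
    filter_upwards [Lp.coeFn_smul d (v : Lp ℝ 2 μ), hv, he1,
      Lp.coeFn_smul d⁻¹ ((u : Lp ℝ 2 μ) - a • (e : Lp ℝ 2 μ)),
      Lp.coeFn_sub (u : Lp ℝ 2 μ) (a • (e : Lp ℝ 2 μ)), Lp.coeFn_smul a (e : Lp ℝ 2 μ)]
      with x k1 k2 k3 k4 k5 k6
    rw [k1, Pi.smul_apply, k2, k4, Pi.smul_apply, k5, Pi.sub_apply, k6, Pi.smul_apply, k3]
    simp only [smul_eq_mul, mul_one, slice]
    rw [mul_min_of_nonneg _ _ hd.le, mul_max_of_nonneg _ _ hd.le, mul_inv_cancel_left₀ hd.ne']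
    simp
  · have h3 : E.form (u - a • e) (u - a • e) = E.form u u := by
      simp only [map_sub, LinearMap.sub_apply, map_smul, LinearMap.smul_apply, he, E.symm e]
      simp
    simp only [map_smul, LinearMap.smul_apply, smul_eq_mul, h3] at hvE ⊢
    calc d * (d * E.form v v) ≤ d * (d * (d⁻¹ * (d⁻¹ * E.form u u))) := by gcongr
      _ = E.form u u := by field_simp

/-- Slicing splits off its energy. -/
lemma exists_slice {E : DirichletForm μ} (hE : E.Conservative) (u : E.domain) (a : ℝ)
    {d : ℝ} (hd : 0 < d) :
    ∃ v : E.domain, ((v : Lp ℝ 2 μ) : Ω → ℝ) =ᵐ[μ] (fun x => slice a d ((u : Lp ℝ 2 μ) x)) ∧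
      E.form v v + E.form (u - v) (u - v) ≤ E.form u u := by
  obtain ⟨v, hv, -⟩ := exists_slice_form_le hE u a hd
  refine ⟨v, hv, ?_⟩
  obtain ⟨e, he1, he⟩ := id hE
  -- Slicing `v + t (u - a - v)` returns `v`, so `E(v) ≤ E(v + t (u - a - v))`; expand, constants
  -- dropping out. Small `t` then forces the linear coefficient to be nonnegative.
  have key : ∀ t : ℝ, 0 ≤ t →
      0 ≤ 2 * t * E.form v (u - v) + t ^ 2 * E.form (u - v) (u - v) := by
    intro t ht
    obtain ⟨w, hw, hwE⟩ := exists_slice_form_le hE (v + t • (u - a • e - v)) 0 hd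
    have hwv : w = v := by
      apply Subtype.ext
      apply Lp.ext
      have h2 : ((v + t • (u - a • e - v) : E.domain) : Lp ℝ 2 μ)
        = (v : Lp ℝ 2 μ) + t • ((u : Lp ℝ 2 μ) - a • (e : Lp ℝ 2 μ) - (v : Lp ℝ 2 μ)) := rfl
      rw [h2] at hw
      filter_upwards [hw, hv, he1,
        Lp.coeFn_add (v : Lp ℝ 2 μ) (t • ((u : Lp ℝ 2 μ) - a • (e : Lp ℝ 2 μ) - (v : Lp ℝ 2 μ))),
        Lp.coeFn_smul t ((u : Lp ℝ 2 μ) - a • (e : Lp ℝ 2 μ) - (v : Lp ℝ 2 μ)),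
        Lp.coeFn_sub ((u : Lp ℝ 2 μ) - a • (e : Lp ℝ 2 μ)) (v : Lp ℝ 2 μ),
        Lp.coeFn_sub (u : Lp ℝ 2 μ) (a • (e : Lp ℝ 2 μ)), Lp.coeFn_smul a (e : Lp ℝ 2 μ)]
        with x k1 k2 k3 k4 k5 k6 k7 k8
      rw [k1, k4, Pi.add_apply, k5, Pi.smul_apply, k6, Pi.sub_apply, k7, Pi.sub_apply, k8,
        Pi.smul_apply, k3, k2]
      have := slice_slice_add_mul d ((u : Lp ℝ 2 μ) x - a) t hd.le ht
      have h0 : slice 0 d ((u : Lp ℝ 2 μ) x - a) = slice a d ((u : Lp ℝ 2 μ) x) := by simp [slice]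
      rw [h0] at this
      simpa using this
    rw [hwv] at hwE
    have h3 : E.form (v + t • (u - a • e - v)) (v + t • (u - a • e - v)) =
        E.form v v + (2 * t * E.form v (u - v) + t ^ 2 * E.form (u - v) (u - v)) := by
      simp only [map_add, map_sub, LinearMap.sub_apply, LinearMap.add_apply, map_smul,
        LinearMap.smul_apply, he, E.symm e, E.symm u v, smul_eq_mul]
      ring
    linarith
  have hcross : 0 ≤ E.form v (u - v) := by
    by_contra! hneg
    have hD := E.nonneg (u - v)
    set D := E.form (u - v) (u - v)
    set c := E.form v (u - v)
    -- With `D + 1` instead of `D` the choice of `t` also covers `D = 0`.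
    have := key (-c / (D + 1)) (div_nonneg (by linarith) (by linarith))
    have h5 : 2 * (-c / (D + 1)) * c + (-c / (D + 1)) ^ 2 * D
        = -(c ^ 2 * (D + 2) / (D + 1) ^ 2) := by
      field_simp
      ring
    have h6 : 0 < c ^ 2 * (D + 2) / (D + 1) ^ 2 := by
      have : 0 < c ^ 2 := by nlinarith
      have : 0 < D + 1 := by linarith
      have : 0 < D + 2 := by linarith
      positivity
    linarith
  have h4 : E.form u u = E.form v v + 2 * E.form v (u - v) + E.form (u - v) (u - v) := by
    simp only [map_sub, LinearMap.sub_apply, E.symm u v]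
    ring
  linarith

/-- Cutting a function into slices does not increase the total energy. -/
lemma exists_slices {E : DirichletForm μ} (hE : E.Conservative) (u : E.domain) {a : ℕ → ℝ}
    (ha : StrictMono a) :
    ∃ g : ℕ → E.domain, (∀ k, ((g k : Lp ℝ 2 μ) : Ω → ℝ) =ᵐ[μ]
        (fun x => slice (a k) (a (k + 1) - a k) ((u : Lp ℝ 2 μ) x))) ∧
      ∀ K, ∑ k ∈ Finset.range K, E.form (g k) (g k) ≤ E.form u u := by
  choose g hg _ using fun k =>
    exists_slice hE u (a k) (sub_pos.2 (ha (Nat.lt_succ_self k)))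
  refine ⟨g, hg, ?_⟩
  have hr : ∀ K, (((u - ∑ k ∈ Finset.range K, g k : E.domain) : Lp ℝ 2 μ) : Ω → ℝ) =ᵐ[μ]
      fun x => (u : Lp ℝ 2 μ) x - slice (a 0) (a K - a 0) ((u : Lp ℝ 2 μ) x) := by
    intro K
    have h1 : ∀ K, (((∑ k ∈ Finset.range K, g k : E.domain) : Lp ℝ 2 μ) : Ω → ℝ) =ᵐ[μ]
        fun x => ∑ k ∈ Finset.range K, slice (a k) (a (k + 1) - a k) ((u : Lp ℝ 2 μ) x) := by
      intro K
      induction K with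
      | zero =>
        simp only [Finset.range_zero, Finset.sum_empty]
        exact Lp.coeFn_zero ℝ 2 μ
      | succ K ih =>
        simp only [Finset.sum_range_succ]
        filter_upwards [ih, hg K, Lp.coeFn_add
          ((∑ k ∈ Finset.range K, g k : E.domain) : Lp ℝ 2 μ) (g K)] with x k1 k2 k3
        rw [← k1, ← k2]
        exact k3
    filter_upwards [h1 K, Lp.coeFn_sub (u : Lp ℝ 2 μ)
      ((∑ k ∈ Finset.range K, g k : E.domain) : Lp ℝ 2 μ)] with x k1 k2
    rw [← sum_range_slice ha.monotone, ← k1]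
    exact k2
  have key : ∀ K, ∑ k ∈ Finset.range K, E.form (g k) (g k) +
      E.form (u - ∑ k ∈ Finset.range K, g k) (u - ∑ k ∈ Finset.range K, g k) ≤ E.form u u := by
    intro K
    induction K with
    | zero => simp
    | succ K ih =>
      obtain ⟨v, hv, hvE⟩ := exists_slice hE (u - ∑ k ∈ Finset.range K, g k) (a 0)
        (sub_pos.2 (ha (Nat.lt_succ_self K)))
      have hvg : v = g K := by
        apply Subtype.ext
        apply Lp.ext
        filter_upwards [hv, hg K, hr K] with x k1 k2 k3
        rw [k1, k2, k3]
        exact slice_sub_slice (ha.monotone (Nat.zero_le K)) (ha.monotone (Nat.le_succ K)) _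
      rw [hvg] at hvE
      rw [Finset.sum_range_succ, Finset.sum_range_succ, ← sub_sub]
      linarith
  intro K
  linarith [key K, E.nonneg (u - ∑ k ∈ Finset.range K, g k)]

end DirichletForm

/-! ### Fatou's lemma and infima. -/

/-- Fatou for truncations: the `K` from which `F K` dominates `h` may depend on the point, and
integrability of `h` is part of the conclusion. -/
lemma integrable_and_integral_le_of_eventually_le {Ω : Type*} [MeasurableSpace Ω]
    {μ : Measure Ω} {h : Ω → ℝ} {F : ℕ → Ω → ℝ} {B : ℝ}
    (hm : AEStronglyMeasurable h μ) (h0 : ∀ x, 0 ≤ h x) (hF : ∀ K, Integrable (F K) μ)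
    (hF0 : ∀ K, 0 ≤ᵐ[μ] F K) (hev : ∀ᵐ x ∂μ, ∀ᶠ K in atTop, h x ≤ F K x)
    (hB : ∀ K, ∫ x, F K x ∂μ ≤ B) :
    Integrable h μ ∧ ∫ x, h x ∂μ ≤ B := by
  have hB0 : 0 ≤ B := (integral_nonneg_of_ae (hF0 0)).trans (hB 0)
  have hle : ∫⁻ x, ENNReal.ofReal (h x) ∂μ ≤ ENNReal.ofReal B := by
    calc ∫⁻ x, ENNReal.ofReal (h x) ∂μ
        ≤ ∫⁻ x, liminf (fun K => ENNReal.ofReal (F K x)) atTop ∂μ := by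
          apply lintegral_mono_ae
          filter_upwards [hev] with x hx
          apply le_liminf_of_le
          · isBoundedDefault
          · filter_upwards [hx] with K hK using ENNReal.ofReal_le_ofReal hK
      _ ≤ liminf (fun K => ∫⁻ x, ENNReal.ofReal (F K x) ∂μ) atTop :=
          lintegral_liminf_le' fun K => (hF K).aemeasurable.ennreal_ofReal
      _ ≤ ENNReal.ofReal B := by
          apply liminf_le_of_le
          · isBoundedDefault
          · intro b hb
            obtain ⟨K, hK⟩ := hb.exists
            refine hK.trans ?_
            rw [← ofReal_integral_eq_lintegral_ofReal (hF K) (hF0 K)]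
            exact ENNReal.ofReal_le_ofReal (hB K)
  refine ⟨⟨hm, ?_⟩, ?_⟩
  · rw [hasFiniteIntegral_iff_ofReal (Eventually.of_forall h0)]
    exact hle.trans_lt ENNReal.ofReal_lt_top
  · rw [integral_eq_lintegral_of_nonneg_ae (Eventually.of_forall h0) hm]
    exact ENNReal.toReal_le_of_le_ofReal hB0 hle

lemma infBot_of_nonempty {S : Set ℝ} (hS : S.Nonempty) : infBot S = ((sInf S : ℝ) : EReal) :=
  if_pos hS

lemma nonempty_of_infBot_ne_bot {S : Set ℝ} (h : infBot S ≠ ⊥) : S.Nonempty := by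
  by_contra hS
  exact h (if_neg hS)

lemma le_sInf_mul {S : Set ℝ} (hS : S.Nonempty) {A B : ℝ} (hB : 0 ≤ B)
    (h : ∀ y ∈ S, A ≤ y * B) : A ≤ sInf S * B := by
  rcases hB.eq_or_lt with rfl | hB
  · obtain ⟨y, hy⟩ := hS
    simpa using h y hy
  · rw [← div_le_iff₀ hB]
    exact le_csInf hS fun y hy => (div_le_iff₀ hB).2 (h y hy)

/-! ### Pointwise inequalities and Cauchy–Schwarz. -/

/-- Slicing `x` and `-x` between consecutive powers of `q` controls `x² log x²`. -/
lemma sq_mul_log_sq_le {q : ℝ} (hq : 1 < q) (N K : ℕ) {x : ℝ} (hx : |x| < q ^ K) :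
    x ^ 2 * Real.log (x ^ 2) ≤ 2 * Real.log q * (N + 1) * x ^ 2 +
      ∑ j ∈ Finset.Ico N K, 2 * Real.log q * (j + 2) * (q ^ 4 / (q - 1) ^ 2) *
        (slice (q ^ j) (q ^ (j + 1) - q ^ j) x ^ 2 +
          slice (q ^ j) (q ^ (j + 1) - q ^ j) (-x) ^ 2) := by
  have hL : 0 < Real.log q := Real.log_pos hq
  have hq0 : 0 < q := by linarith
  have hterm : ∀ j ∈ Finset.Ico N K, 0 ≤ 2 * Real.log q * (j + 2) * (q ^ 4 / (q - 1) ^ 2) *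
        (slice (q ^ j) (q ^ (j + 1) - q ^ j) x ^ 2 +
          slice (q ^ j) (q ^ (j + 1) - q ^ j) (-x) ^ 2) := by
    intro j _
    positivity
  have hlog : ∀ n : ℕ, |x| ≤ q ^ n → x ^ 2 * Real.log (x ^ 2) ≤ 2 * Real.log q * n * x ^ 2 := by
    intro n hn
    rcases eq_or_ne x 0 with rfl | h0
    · simp
    have h1 : Real.log (x ^ 2) ≤ 2 * Real.log q * n := by
      rw [Real.log_pow, ← Real.log_abs]
      have := Real.log_le_log (abs_pos.2 h0) hn
      rw [Real.log_pow] at this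
      push_cast
      linarith
    nlinarith [sq_nonneg x]
  rcases le_total |x| (q ^ (N + 1)) with h | h
  · have := hlog _ h
    have := Finset.sum_nonneg hterm
    push_cast at *
    linarith
  · obtain ⟨m, hm1, hm2⟩ := exists_nat_pow_near (one_le_pow₀ hq.le |>.trans h) hq
    have hNm : N + 1 ≤ m := by
      have := (pow_lt_pow_iff_right₀ hq).1 (h.trans_lt hm2)
      omega
    have hmK : m < K := (pow_lt_pow_iff_right₀ hq).1 (hm1.trans_lt hx)
    -- As `q ^ (j + 1) ≤ |x| < q ^ (j + 2)`, slice `j` of `x` or `-x` is full; `q ^ 4 / (q - 1) ^ 2`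
    -- compares `q ^ (2 * (j + 2))` with its squared width.
    obtain ⟨j, rfl⟩ : ∃ j, m = j + 1 := ⟨m - 1, by omega⟩
    have hsum := Finset.single_le_sum hterm (Finset.mem_Ico.2 ⟨by omega, by omega⟩ : j ∈ _)
    have hj := hlog _ hm2.le
    have hd : 0 ≤ q ^ (j + 1) - q ^ j := sub_nonneg.2 (pow_le_pow_right₀ hq.le (by omega))
    have hslice : (q ^ (j + 1) - q ^ j) ^ 2 ≤ slice (q ^ j) (q ^ (j + 1) - q ^ j) x ^ 2 +
          slice (q ^ j) (q ^ (j + 1) - q ^ j) (-x) ^ 2 := by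
      rcases abs_cases x with ⟨hx', _⟩ | ⟨hx', _⟩
      · rw [slice_eq_width hd (y := x) (by linarith)]
        exact le_add_of_nonneg_right (sq_nonneg _)
      · rw [slice_eq_width hd (y := -x) (by linarith)]
        exact le_add_of_nonneg_left (sq_nonneg _)
    have hx2 : x ^ 2 ≤ q ^ 4 / (q - 1) ^ 2 * (q ^ (j + 1) - q ^ j) ^ 2 := by
      have e : q ^ 4 / (q - 1) ^ 2 * (q ^ (j + 1) - q ^ j) ^ 2 = (q ^ (j + 1 + 1)) ^ 2 := by
        have : q - 1 ≠ 0 := by linarith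
        field_simp
        ring
      rw [e, ← sq_abs]
      gcongr
    have hκ : 0 ≤ q ^ 4 / (q - 1) ^ 2 := by positivity
    calc x ^ 2 * Real.log (x ^ 2) ≤ 2 * Real.log q * (j + 2) * x ^ 2 := by
          push_cast at hj
          linarith
      _ ≤ 2 * Real.log q * (j + 2) * (q ^ 4 / (q - 1) ^ 2 * (q ^ (j + 1) - q ^ j) ^ 2) := by
          gcongr
      _ ≤ 2 * Real.log q * (j + 2) * (q ^ 4 / (q - 1) ^ 2 *
          (slice (q ^ j) (q ^ (j + 1) - q ^ j) x ^ 2 +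
          slice (q ^ j) (q ^ (j + 1) - q ^ j) (-x) ^ 2)) := by gcongr
      _ ≤ _ := by
          rw [← mul_assoc]
          have : 0 ≤ 2 * Real.log q * (N + 1) * x ^ 2 := by positivity
          linarith

/-- Tangent line of the convex function `z log z` at `p`. Where the slice vanishes the constant `-p`
is not needed, hence the indicator. -/
lemma slice_sq_log_ge {a d y p : ℝ} (hd : 0 ≤ d) (hp : 0 < p) :
    slice a d y ^ 2 * Real.log p + slice a d y ^ 2 - (if a < y then p else 0) ≤
      slice a d y ^ 2 * Real.log (slice a d y ^ 2) := by
  split_ifs with h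
  · rcases (slice_nonneg a y hd).eq_or_lt with h0 | h0
    · rw [← h0]
      simp [hp.le]
    · set z := slice a d y ^ 2
      have hz : 0 < z := by positivity
      have := Real.log_le_sub_one_of_pos (div_pos hp hz)
      rw [Real.log_div hp.ne' hz.ne'] at this
      have h2 : z * (p / z - 1) = p - z := by field_simp
      nlinarith
  · rw [slice_eq_zero hd (not_lt.1 h)]
    simp

/-- For `a ≥ 0`: if `|y| ≤ 2a` the linear term suffices, otherwise `|y| ≤ 2(|y| - a)`, whence the
factor `4`. The hypothesis says the slice is not truncated. -/
lemma sq_le_slice {a y : ℝ} (M : ℕ) (h : |y| - a ≤ M + 1) :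
    y ^ 2 ≤ 4 * (slice a (M + 1) y ^ 2 + slice a (M + 1) (-y) ^ 2) + 2 * a * |y| := by
  have key : ∀ z : ℝ, 0 ≤ z → z - a ≤ M + 1 → z ^ 2 ≤ 4 * slice a (M + 1) z ^ 2 + 2 * a * z := by
    intro z hz hz'
    rcases le_total z (2 * a) with h1 | h1
    · nlinarith [sq_nonneg (slice a (M + 1) z)]
    · rcases le_total a z with h2 | h2
      · rw [slice_eq_sub h2 (by linarith)]
        nlinarith [sq_nonneg (z - 2 * a), sq_nonneg a]
      · nlinarith [sq_nonneg (slice a (M + 1) z)]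
  have := key |y| (abs_nonneg y) h
  rw [sq_abs] at this
  rcases abs_cases y with ⟨e, _⟩ | ⟨e, _⟩ <;> rw [e] at this ⊢
  · nlinarith [sq_nonneg (slice a (M + 1) (-y))]
  · nlinarith [sq_nonneg (slice a (M + 1) y)]

/-- Cauchy–Schwarz on the support of `g`, with `w` majorizing its indicator: integrate `2 (m/t) |g|
≤ g² + (m/t)² w`. -/
lemma sq_integral_abs_le {Ω : Type*} [MeasurableSpace Ω] {μ : Measure Ω} {g w : Ω → ℝ} {t : ℝ}
    (ht : 0 < t) (hg : Integrable g μ) (hg2 : Integrable (fun x => g x ^ 2) μ)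
    (hw : Integrable w μ) (hwt : ∫ x, w x ∂μ ≤ t) (hw0 : ∀ x, 0 ≤ w x)
    (hgw : ∀ᵐ x ∂μ, g x = 0 ∨ 1 ≤ w x) :
    (∫ x, |g x| ∂μ) ^ 2 ≤ t * ∫ x, g x ^ 2 ∂μ := by
  set m := ∫ x, |g x| ∂μ
  have h1 : ∫ x, 2 * (m / t) * |g x| ∂μ ≤ ∫ x, (g x ^ 2 + (m / t) ^ 2 * w x) ∂μ := by
    refine integral_mono_ae (hg.abs.const_mul _) (hg2.add (hw.const_mul _)) ?_
    filter_upwards [hgw] with x hx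
    have h2 : 0 ≤ (m / t) ^ 2 := sq_nonneg _
    rcases hx with hx | hx
    · simpa [hx] using mul_nonneg h2 (hw0 x)
    · show 2 * (m / t) * |g x| ≤ g x ^ 2 + (m / t) ^ 2 * w x
      nlinarith [sq_nonneg (|g x| - m / t), sq_abs (g x)]
  rw [integral_const_mul, integral_add hg2 (hw.const_mul _), integral_const_mul] at h1
  have h3 : (m / t) ^ 2 * ∫ x, w x ∂μ ≤ (m / t) ^ 2 * t := by gcongr
  have h4 : 2 * (m / t) * m - (m / t) ^ 2 * t = m ^ 2 / t := by field_simp; ring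
  have h5 : m ^ 2 / t ≤ ∫ x, g x ^ 2 ∂μ := by linarith
  rwa [div_le_iff₀' ht] at h5

namespace DirichletForm

variable {Ω : Type*} [MeasurableSpace Ω] {μ : Measure Ω}

lemma integrable_sq {E : DirichletForm μ} (f : E.domain) :
    Integrable (fun x => (f : Lp ℝ 2 μ) x ^ 2) μ :=
  (Lp.memLp (f : Lp ℝ 2 μ)).integrable_sq

lemma integrable_coe [IsFiniteMeasure μ] {E : DirichletForm μ} (f : E.domain) :
    Integrable (f : Lp ℝ 2 μ) μ :=
  (Lp.memLp (f : Lp ℝ 2 μ)).integrable (by norm_num)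

lemma coe_neg_ae {E : DirichletForm μ} (f : E.domain) :
    (((-f : E.domain) : Lp ℝ 2 μ) : Ω → ℝ) =ᵐ[μ] fun x => -(f : Lp ℝ 2 μ) x :=
  Lp.coeFn_neg (f : Lp ℝ 2 μ)

end DirichletForm

/-! ### From super-Poincaré to super log-Sobolev. -/

/-- Under a super-Poincaré inequality, a function vanishing off a set of measure at most `t`
satisfies a Poincaré inequality with constant `ξ₁(t)`. -/
lemma SuperPoincare.integral_sq_le {Ω : Type*} [MeasurableSpace Ω] {μ : Measure Ω}
    [IsFiniteMeasure μ] {E : DirichletForm μ} {β : ℝ → ℝ} (h : SuperPoincare E β) {t : ℝ}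
    (ht : 0 < t) (hS : xi1 β t ≠ ⊥) (g : E.domain) {w : Ω → ℝ} (hw : Integrable w μ)
    (hwt : ∫ x, w x ∂μ ≤ t) (hw0 : ∀ x, 0 ≤ w x)
    (hgw : ∀ᵐ x ∂μ, (g : Lp ℝ 2 μ) x = 0 ∨ 1 ≤ w x) :
    ∫ x, (g : Lp ℝ 2 μ) x ^ 2 ∂μ ≤ (xi1 β t).toReal * E.form g g := by
  have hne := nonempty_of_infBot_ne_bot hS
  rw [xi1, infBot_of_nonempty hne, EReal.toReal_coe]
  refine le_sInf_mul hne (E.nonneg g) ?_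
  rintro y ⟨r, hr, hr1, rfl⟩
  have h1 := h.2 r hr g
  have h2 := sq_integral_abs_le ht (DirichletForm.integrable_coe g)
    (DirichletForm.integrable_sq g) hw hwt hw0 hgw
  have h3 := mul_le_mul_of_nonneg_left h2 (h.1.2 r hr)
  rw [div_mul_eq_mul_div, le_div_iff₀ hr1]
  linarith

lemma sum_integral_slice_sq_le {Ω : Type*} [MeasurableSpace Ω] {μ : Measure Ω}
    [IsFiniteMeasure μ] {E : DirichletForm μ} (hE : E.Conservative) {β : ℝ → ℝ}
    (h : SuperPoincare E β) {q : ℝ} (hq : 1 < q) {N K : ℕ} {c : ℕ → ℝ} {s : ℝ}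
    (hc0 : ∀ j, 0 ≤ c j) (hs : 0 ≤ s)
    (hc : ∀ j, N ≤ j → xi1 β ((q ^ (2 * j))⁻¹) ≠ ⊥ ∧ c j * (xi1 β ((q ^ (2 * j))⁻¹)).toReal ≤ s)
    (f : E.domain) (hf : ∫ x, (f : Lp ℝ 2 μ) x ^ 2 ∂μ ≤ 1) :
    (∀ j, Integrable (fun x => slice (q ^ j) (q ^ (j + 1) - q ^ j) ((f : Lp ℝ 2 μ) x) ^ 2) μ) ∧
      ∑ j ∈ Finset.Ico N K,
        c j * ∫ x, slice (q ^ j) (q ^ (j + 1) - q ^ j) ((f : Lp ℝ 2 μ) x) ^ 2 ∂μ ≤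
      s * E.form f f := by
  have hq0 : 0 < q := by linarith
  obtain ⟨g, hg, hgE⟩ := DirichletForm.exists_slices hE f (pow_right_strictMono₀ hq)
  have hsq : ∀ j, (fun x => (g j : Lp ℝ 2 μ) x ^ 2) =ᵐ[μ]
      fun x => slice (q ^ j) (q ^ (j + 1) - q ^ j) ((f : Lp ℝ 2 μ) x) ^ 2 := by
    intro j
    filter_upwards [hg j] with x hx
    rw [hx]
  refine ⟨fun j => (DirichletForm.integrable_sq (g j)).congr (hsq j), ?_⟩
  calc ∑ j ∈ Finset.Ico N K,
        c j * ∫ x, slice (q ^ j) (q ^ (j + 1) - q ^ j) ((f : Lp ℝ 2 μ) x) ^ 2 ∂μ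
      ≤ ∑ j ∈ Finset.Ico N K, s * E.form (g j) (g j) := by
        refine Finset.sum_le_sum fun j hj => ?_
        obtain ⟨hξ, hξs⟩ := hc j (Finset.mem_Ico.1 hj).1
        rw [← integral_congr_ae (hsq j)]
        have := h.integral_sq_le (by positivity) hξ (g j)
          -- Chebyshev: this weight is at least `1` where `f ≥ q ^ j`, and its integral is at most
          -- `q ^ (-2j)`.
          (w := fun x => (q ^ (2 * j))⁻¹ * (f : Lp ℝ 2 μ) x ^ 2)
          ((DirichletForm.integrable_sq f).const_mul _)
          (by
            rw [integral_const_mul]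
            exact mul_le_of_le_one_right (by positivity) hf)
          (fun x => by positivity)
          (by
            filter_upwards [hg j] with x hx
            rw [hx]
            rcases le_total ((f : Lp ℝ 2 μ) x) (q ^ j) with h' | h'
            · exact Or.inl (slice_eq_zero
                (sub_nonneg.2 (pow_le_pow_right₀ hq.le (Nat.le_succ j))) h')
            · right
              rw [inv_mul_eq_div, one_le_div (by positivity), mul_comm, pow_mul]
              gcongr)
        calc c j * ∫ x, (g j : Lp ℝ 2 μ) x ^ 2 ∂μ
            ≤ c j * ((xi1 β ((q ^ (2 * j))⁻¹)).toReal * E.form (g j) (g j)) := by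
              gcongr
              exact hc0 j
          _ = c j * (xi1 β ((q ^ (2 * j))⁻¹)).toReal * E.form (g j) (g j) := by ring
          _ ≤ s * E.form (g j) (g j) := mul_le_mul_of_nonneg_right hξs (E.nonneg _)
    _ = s * ∑ j ∈ Finset.Ico N K, E.form (g j) (g j) := by rw [Finset.mul_sum]
    _ ≤ s * E.form f f := by
        gcongr
        refine (Finset.sum_le_sum_of_subset_of_nonneg ?_ fun j _ _ => E.nonneg _).trans (hgE K)
        intro j hj
        exact Finset.mem_range.2 (Finset.mem_Ico.1 hj).2

lemma neg_one_le_sq_mul_log (y : ℝ) : -1 ≤ y ^ 2 * Real.log (y ^ 2) := by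
  rcases eq_or_ne y 0 with rfl | hy
  · simp
  have h := Real.one_sub_inv_le_log_of_pos (show 0 < y ^ 2 by positivity)
  have h2 : y ^ 2 * (1 - (y ^ 2)⁻¹) = y ^ 2 - 1 := by field_simp
  nlinarith [sq_nonneg y]

/-- The super log-Sobolev estimate for normalized functions. -/
lemma SuperPoincare.integral_sq_log_le_of_norm_eq_one {Ω : Type*} [MeasurableSpace Ω]
    {μ : Measure Ω} [IsProbabilityMeasure μ] {E : DirichletForm μ} (hE : E.Conservative)
    {β : ℝ → ℝ} (h : SuperPoincare E β) {q : ℝ} (hq : 1 < q) {N : ℕ} {s : ℝ} (hs : 0 ≤ s)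
    (hN : ∀ j, N ≤ j → xi1 β ((q ^ (2 * j))⁻¹) ≠ ⊥ ∧
      4 * Real.log q * (j + 2) * (q ^ 4 / (q - 1) ^ 2) * (xi1 β ((q ^ (2 * j))⁻¹)).toReal ≤ s)
    (f : E.domain) (hf : ∫ x, (f : Lp ℝ 2 μ) x ^ 2 ∂μ = 1) :
    Integrable (fun x => (f : Lp ℝ 2 μ) x ^ 2 * Real.log ((f : Lp ℝ 2 μ) x ^ 2)) μ ∧
      ∫ x, (f : Lp ℝ 2 μ) x ^ 2 * Real.log ((f : Lp ℝ 2 μ) x ^ 2) ∂μ ≤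
        s * E.form f f + 2 * Real.log q * (N + 1) := by
  have hL : 0 < Real.log q := Real.log_pos hq
  set c : ℕ → ℝ := fun j => 2 * Real.log q * (j + 2) * (q ^ 4 / (q - 1) ^ 2) with hcdef
  have hc0 : ∀ j, 0 ≤ c j := fun j => by positivity
  -- Half of `s` for the slices of `f`, half for those of `-f`.
  have hc : ∀ j, N ≤ j → xi1 β ((q ^ (2 * j))⁻¹) ≠ ⊥ ∧
      c j * (xi1 β ((q ^ (2 * j))⁻¹)).toReal ≤ s / 2 := by
    intro j hj
    refine ⟨(hN j hj).1, ?_⟩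
    have := (hN j hj).2
    simp only [hcdef]
    linarith
  have hneg : (fun x => ((-f : E.domain) : Lp ℝ 2 μ) x) =ᵐ[μ] fun x => -(f : Lp ℝ 2 μ) x :=
    DirichletForm.coe_neg_ae f
  have hfneg : ∫ x, ((-f : E.domain) : Lp ℝ 2 μ) x ^ 2 ∂μ = 1 := by
    rw [← hf]
    refine integral_congr_ae ?_
    filter_upwards [hneg] with x hx
    rw [hx, neg_sq]
  have hEneg : E.form (-f) (-f) = E.form f f := by simp
  have hP := fun K => sum_integral_slice_sq_le hE h hq (K := K) hc0 (by positivity) hc f hf.le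
  have hM := fun K => sum_integral_slice_sq_le hE h hq (K := K) hc0 (by positivity) hc (-f) hfneg.le
  have hMe : ∀ j, (fun x => slice (q ^ j) (q ^ (j + 1) - q ^ j)
      (((-f : E.domain) : Lp ℝ 2 μ) x) ^ 2) =ᵐ[μ]
      fun x => slice (q ^ j) (q ^ (j + 1) - q ^ j) (-(f : Lp ℝ 2 μ) x) ^ 2 := by
    intro j
    filter_upwards [hneg] with x hx
    rw [hx]
  have hPi := (hP 0).1
  have hMi := fun j => ((hM 0).1 j).congr (hMe j)
  -- The summand `1` compensates `f² log f² ≥ -1`, so that Fatou applies to nonnegative functions.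
  set F : ℕ → Ω → ℝ := fun K x => 1 + 2 * Real.log q * (N + 1) * (f : Lp ℝ 2 μ) x ^ 2 +
      ∑ j ∈ Finset.Ico N K, c j *
        (slice (q ^ j) (q ^ (j + 1) - q ^ j) ((f : Lp ℝ 2 μ) x) ^ 2 +
          slice (q ^ j) (q ^ (j + 1) - q ^ j) (-(f : Lp ℝ 2 μ) x) ^ 2) with hFdef
  have hi1 : Integrable (fun x => 1 + 2 * Real.log q * (N + 1) * (f : Lp ℝ 2 μ) x ^ 2) μ :=
    (integrable_const 1).add ((DirichletForm.integrable_sq f).const_mul _)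
  have hi2 : ∀ j, Integrable (fun x => c j *
        (slice (q ^ j) (q ^ (j + 1) - q ^ j) ((f : Lp ℝ 2 μ) x) ^ 2 +
          slice (q ^ j) (q ^ (j + 1) - q ^ j) (-(f : Lp ℝ 2 μ) x) ^ 2)) μ := fun j =>
    ((hPi j).add (hMi j)).const_mul _
  have hi3 := fun K => integrable_finsetSum (Finset.Ico N K) fun j _ => hi2 j
  have hmeas : AEStronglyMeasurable
      (fun x => (f : Lp ℝ 2 μ) x ^ 2 * Real.log ((f : Lp ℝ 2 μ) x ^ 2)) μ := by
    have := (Lp.aestronglyMeasurable (f : Lp ℝ 2 μ)).aemeasurable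
    exact ((this.pow_const 2).mul (this.pow_const 2).log).aestronglyMeasurable
  obtain ⟨hint, hle⟩ := integrable_and_integral_le_of_eventually_le (μ := μ)
    (h := fun x => (f : Lp ℝ 2 μ) x ^ 2 * Real.log ((f : Lp ℝ 2 μ) x ^ 2) + 1) (F := F)
    (B := s * E.form f f + 2 * Real.log q * (N + 1) + 1)
    (hmeas.add aestronglyMeasurable_const)
    (fun x => by linarith [neg_one_le_sq_mul_log ((f : Lp ℝ 2 μ) x)])
    (fun K => hi1.add (hi3 K))
    (fun K => Eventually.of_forall fun x =>
      add_nonneg (by positivity) (Finset.sum_nonneg fun j _ => mul_nonneg (hc0 j) (by positivity)))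
    (Eventually.of_forall fun x => by
      filter_upwards [(tendsto_pow_atTop_atTop_of_one_lt hq).eventually_gt_atTop
        |(f : Lp ℝ 2 μ) x|] with K hK
      have := sq_mul_log_sq_le hq N K hK
      simp only [hFdef, hcdef]
      linarith)
    (fun K => by
      rw [integral_add hi1 (hi3 K), integral_finsetSum _ fun j _ => hi2 j,
        integral_add (integrable_const 1) ((DirichletForm.integrable_sq f).const_mul _),
        integral_const_mul, hf]
      simp_rw [integral_const_mul, integral_add (hPi _) (hMi _), mul_add, Finset.sum_add_distrib]
      have h1 := (hP K).2
      have h2 := (hM K).2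
      simp_rw [integral_congr_ae (hMe _), hEneg] at h2
      simp only [integral_const, probReal_univ, smul_eq_mul]
      linarith)
  have hint' : Integrable
      (fun x => (f : Lp ℝ 2 μ) x ^ 2 * Real.log ((f : Lp ℝ 2 μ) x ^ 2)) μ := by
    refine (hint.sub (integrable_const 1)).congr (Eventually.of_forall fun x => ?_)
    exact add_sub_cancel_right _ _
  refine ⟨hint', ?_⟩
  rw [integral_add hint' (integrable_const 1)] at hle
  simpa using hle

/-- The super log-Sobolev estimate. -/
lemma SuperPoincare.entropySq_le {Ω : Type*} [MeasurableSpace Ω]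
    {μ : Measure Ω} [IsProbabilityMeasure μ] {E : DirichletForm μ} (hE : E.Conservative)
    {β : ℝ → ℝ} (h : SuperPoincare E β) {q : ℝ} (hq : 1 < q) {N : ℕ} {s : ℝ} (hs : 0 ≤ s)
    (hN : ∀ j, N ≤ j → xi1 β ((q ^ (2 * j))⁻¹) ≠ ⊥ ∧
      4 * Real.log q * (j + 2) * (q ^ 4 / (q - 1) ^ 2) * (xi1 β ((q ^ (2 * j))⁻¹)).toReal ≤ s)
    (f : E.domain) :
    Integrable (fun x => (f : Lp ℝ 2 μ) x ^ 2 * Real.log ((f : Lp ℝ 2 μ) x ^ 2)) μ ∧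
      entropySq μ (f : Lp ℝ 2 μ) ≤
        s * E.form f f + 2 * Real.log q * (N + 1) * ∫ x, (f : Lp ℝ 2 μ) x ^ 2 ∂μ := by
  have hsq := DirichletForm.integrable_sq f
  have hA0 : 0 ≤ ∫ x, (f : Lp ℝ 2 μ) x ^ 2 ∂μ := integral_nonneg fun x => sq_nonneg _
  rcases hA0.eq_or_lt with hA | hA
  · have h0 := (integral_eq_zero_iff_of_nonneg (fun x => sq_nonneg _) hsq).1 hA.symm
    have h1 : (fun x => (f : Lp ℝ 2 μ) x ^ 2 * Real.log ((f : Lp ℝ 2 μ) x ^ 2)) =ᵐ[μ] 0 := by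
      filter_upwards [h0] with x hx
      simp only [Pi.zero_apply] at hx ⊢
      rw [hx, zero_mul]
    refine ⟨(integrable_zero _ _ _).congr h1.symm, ?_⟩
    rw [entropySq, integral_congr_ae h1, ← hA]
    simpa using mul_nonneg hs (E.nonneg f)
  set A := ∫ x, (f : Lp ℝ 2 μ) x ^ 2 ∂μ
  have hr : 0 < √A := Real.sqrt_pos.2 hA
  have hr2 : √A ^ 2 = A := Real.sq_sqrt hA.le
  have hco : (((√A)⁻¹ • f : E.domain) : Lp ℝ 2 μ) =ᵐ[μ] fun x => (√A)⁻¹ * (f : Lp ℝ 2 μ) x :=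
    Lp.coeFn_smul _ (f : Lp ℝ 2 μ)
  have hsqco : ∀ᵐ x ∂μ, (((√A)⁻¹ • f : E.domain) : Lp ℝ 2 μ) x ^ 2
      = A⁻¹ * (f : Lp ℝ 2 μ) x ^ 2 := by
    filter_upwards [hco] with x hx
    rw [hx, mul_pow, inv_pow, hr2]
  obtain ⟨hi, hle⟩ := h.integral_sq_log_le_of_norm_eq_one hE hq hs hN ((√A)⁻¹ • f)
    (by rw [integral_congr_ae hsqco, integral_const_mul, inv_mul_cancel₀ hA.ne'])
  have hform : E.form ((√A)⁻¹ • f) ((√A)⁻¹ • f) = A⁻¹ * E.form f f := by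
    simp only [map_smul, LinearMap.smul_apply, smul_eq_mul]
    rw [← mul_assoc, ← mul_inv, ← sq, hr2]
  have hlog : (fun x => (f : Lp ℝ 2 μ) x ^ 2 * Real.log ((f : Lp ℝ 2 μ) x ^ 2)) =ᵐ[μ]
      fun x => A * ((((√A)⁻¹ • f : E.domain) : Lp ℝ 2 μ) x ^ 2 *
        Real.log ((((√A)⁻¹ • f : E.domain) : Lp ℝ 2 μ) x ^ 2)) +
        Real.log A * (f : Lp ℝ 2 μ) x ^ 2 := by
    filter_upwards [hsqco] with x hx
    rw [hx]
    rcases eq_or_ne ((f : Lp ℝ 2 μ) x) 0 with h0 | h0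
    · simp [h0]
    · rw [Real.log_mul (inv_ne_zero hA.ne') (pow_ne_zero 2 h0), Real.log_inv]
      field_simp
      ring
  refine ⟨((hi.const_mul A).add (hsq.const_mul _)).congr hlog.symm, ?_⟩
  rw [entropySq, integral_congr_ae hlog, integral_add (hi.const_mul A) (hsq.const_mul _),
    integral_const_mul, integral_const_mul]
  rw [hform] at hle
  have := mul_le_mul_of_nonneg_left hle hA.le
  have e : A * (s * (A⁻¹ * E.form f f) + 2 * Real.log q * (N + 1)) =
      s * E.form f f + 2 * Real.log q * (N + 1) * A := by
    field_simp
  rw [e] at this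
  linarith

/-! ### From super log-Sobolev to super-Poincaré. -/

/-- Under a super log-Sobolev inequality, a function vanishing off a set of measure at most `1 / R`
satisfies a Poincaré inequality with constant `ξ₂(log R)`. -/
lemma SuperLogSobolev.integral_slice_sq_le {Ω : Type*} [MeasurableSpace Ω] {μ : Measure Ω}
    [IsProbabilityMeasure μ] {E : DirichletForm μ} (hE : E.Conservative) {β : ℝ → ℝ}
    (h : SuperLogSobolev E β) {R : ℝ} (hR : 0 < R) (hS : xi2 β (Real.log R) ≠ ⊥)
    (f : E.domain) (hm : 0 < ∫ x, |(f : Lp ℝ 2 μ) x| ∂μ) {d : ℝ} (hd : 0 < d) :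
    Integrable (fun x => slice (R * ∫ x, |(f : Lp ℝ 2 μ) x| ∂μ) d ((f : Lp ℝ 2 μ) x) ^ 2) μ ∧
    ∫ x, slice (R * ∫ x, |(f : Lp ℝ 2 μ) x| ∂μ) d ((f : Lp ℝ 2 μ) x) ^ 2 ∂μ ≤
      (xi2 β (Real.log R)).toReal * E.form f f := by
  set m := ∫ x, |(f : Lp ℝ 2 μ) x| ∂μ
  obtain ⟨g, hg, hgE⟩ := DirichletForm.exists_slice_form_le hE f (R * m) hd
  have hsq : (fun x => (g : Lp ℝ 2 μ) x ^ 2) =ᵐ[μ]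
      fun x => slice (R * m) d ((f : Lp ℝ 2 μ) x) ^ 2 := by
    filter_upwards [hg] with x hx
    rw [hx]
  have hgi := DirichletForm.integrable_sq g
  refine ⟨hgi.congr hsq, ?_⟩
  rw [← integral_congr_ae hsq]
  have hne := nonempty_of_infBot_ne_bot hS
  rw [xi2, infBot_of_nonempty hne, EReal.toReal_coe]
  refine le_sInf_mul hne (E.nonneg f) ?_
  rintro y ⟨r, hr, hr1, rfl⟩
  rw [div_mul_eq_mul_div, le_div_iff₀ hr1]
  obtain ⟨hi, hent⟩ := h.2 r hr g
  have hrE : r * E.form g g ≤ r * E.form f f := by gcongr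
  have hp0 : 0 ≤ ∫ x, (g : Lp ℝ 2 μ) x ^ 2 ∂μ := integral_nonneg fun x => sq_nonneg _
  rcases hp0.eq_or_lt with hp | hp
  · rw [← hp, zero_mul]
    exact mul_nonneg hr.le (E.nonneg f)
  set p := ∫ x, (g : Lp ℝ 2 μ) x ^ 2 ∂μ
  have hfi := (DirichletForm.integrable_coe f).abs
  have hi1 : Integrable (fun x => (g : Lp ℝ 2 μ) x ^ 2 * Real.log (p * R)) μ := hgi.mul_const _
  have hi2 : Integrable (fun x => p / m * |(f : Lp ℝ 2 μ) x|) μ := hfi.const_mul _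
  -- Tangent at `p R`, with `p = ∫ g²`. By Markov's inequality, `(p / m) |f|` majorizes `p R` on `{f
  -- > R m}`; its integral is exactly `p`, cancelling the `+ g²` term and leaving `p log (p R)`.
  have hlow : ∫ x, ((g : Lp ℝ 2 μ) x ^ 2 * Real.log (p * R) + (g : Lp ℝ 2 μ) x ^ 2
      - p / m * |(f : Lp ℝ 2 μ) x|) ∂μ ≤
      ∫ x, (g : Lp ℝ 2 μ) x ^ 2 * Real.log ((g : Lp ℝ 2 μ) x ^ 2) ∂μ := by
    refine integral_mono_ae ((hi1.add hgi).sub hi2) hi ?_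
    filter_upwards [hg] with x hx
    have h1 := slice_sq_log_ge (a := R * m) (y := (f : Lp ℝ 2 μ) x) hd.le (mul_pos hp hR)
    rw [← hx] at h1
    have h2 : (if R * m < (f : Lp ℝ 2 μ) x then p * R else 0) ≤ p / m * |(f : Lp ℝ 2 μ) x| := by
      split_ifs with hlt
      · calc p * R = p / m * (R * m) := by field_simp
          _ ≤ p / m * |(f : Lp ℝ 2 μ) x| := by
            gcongr
            exact hlt.le.trans (le_abs_self _)
      · positivity
    linarith
  have e1 : ∫ x, ((g : Lp ℝ 2 μ) x ^ 2 * Real.log (p * R) + (g : Lp ℝ 2 μ) x ^ 2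
      - p / m * |(f : Lp ℝ 2 μ) x|) ∂μ = p * Real.log (p * R) + p - p / m * m := by
    have hi3 : Integrable (fun x => (g : Lp ℝ 2 μ) x ^ 2 * Real.log (p * R)
      + (g : Lp ℝ 2 μ) x ^ 2) μ := hi1.add hgi
    rw [integral_sub hi3 hi2, integral_add hi1 hgi, integral_mul_const,
      integral_const_mul]
  rw [e1, div_mul_cancel₀ _ hm.ne', Real.log_mul hp.ne' hR.ne'] at hlow
  rw [entropySq] at hent
  change _ - p * Real.log p ≤ _ + β r * p at hent
  linarith

/-- The super-Poincaré estimate. -/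
lemma SuperLogSobolev.integral_sq_le {Ω : Type*} [MeasurableSpace Ω] {μ : Measure Ω}
    [IsProbabilityMeasure μ] {E : DirichletForm μ} (hE : E.Conservative) {β : ℝ → ℝ}
    (h : SuperLogSobolev E β) {R : ℝ} (hR : 0 < R) (hS : xi2 β (Real.log R) ≠ ⊥)
    (f : E.domain) :
    ∫ x, (f : Lp ℝ 2 μ) x ^ 2 ∂μ ≤ 8 * (xi2 β (Real.log R)).toReal * E.form f f +
      2 * R * (∫ x, |(f : Lp ℝ 2 μ) x| ∂μ) ^ 2 := by
  have hξ : 0 ≤ (xi2 β (Real.log R)).toReal := by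
    have hne := nonempty_of_infBot_ne_bot hS
    rw [xi2, infBot_of_nonempty hne, EReal.toReal_coe]
    refine Real.sInf_nonneg ?_
    rintro y ⟨r, hr, hr1, rfl⟩
    positivity
  have hfi := (DirichletForm.integrable_coe f).abs
  have hm0 : 0 ≤ ∫ x, |(f : Lp ℝ 2 μ) x| ∂μ := integral_nonneg fun x => abs_nonneg _
  rcases hm0.eq_or_lt with hm | hm
  · have h0 := (integral_eq_zero_iff_of_nonneg (fun x => abs_nonneg _) hfi).1 hm.symm
    have h1 : (fun x => (f : Lp ℝ 2 μ) x ^ 2) =ᵐ[μ] 0 := by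
      filter_upwards [h0] with x hx
      simpa using hx
    rw [integral_congr_ae h1, ← hm]
    simpa using mul_nonneg (mul_nonneg (by norm_num) hξ) (E.nonneg f)
  have hneg : (fun x => ((-f : E.domain) : Lp ℝ 2 μ) x) =ᵐ[μ] fun x => -(f : Lp ℝ 2 μ) x :=
    DirichletForm.coe_neg_ae f
  have hmneg : ∫ x, |((-f : E.domain) : Lp ℝ 2 μ) x| ∂μ = ∫ x, |(f : Lp ℝ 2 μ) x| ∂μ := by
    refine integral_congr_ae ?_
    filter_upwards [hneg] with x hx
    rw [hx, abs_neg]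
  have hEneg : E.form (-f) (-f) = E.form f f := by simp
  have hP := fun M : ℕ => h.integral_slice_sq_le hE hR hS f hm (d := M + 1) (by positivity)
  have hM := fun M : ℕ => h.integral_slice_sq_le hE hR hS (-f) (hmneg ▸ hm) (d := M + 1)
    (by positivity)
  rw [hmneg, hEneg] at hM
  set m := ∫ x, |(f : Lp ℝ 2 μ) x| ∂μ
  have hMe : ∀ M : ℕ, (fun x => slice (R * m) (M + 1) (((-f : E.domain) : Lp ℝ 2 μ) x) ^ 2) =ᵐ[μ]
      fun x => slice (R * m) (M + 1) (-(f : Lp ℝ 2 μ) x) ^ 2 := by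
    intro M
    filter_upwards [hneg] with x hx
    rw [hx]
  have hMi := fun M => (hM M).1.congr (hMe M)
  have hi1 : ∀ M : ℕ, Integrable (fun x => 4 * (slice (R * m) (M + 1) ((f : Lp ℝ 2 μ) x) ^ 2 +
      slice (R * m) (M + 1) (-(f : Lp ℝ 2 μ) x) ^ 2)) μ := fun M =>
    ((hP M).1.add (hMi M)).const_mul _
  have hi2 : Integrable (fun x => 2 * (R * m) * |(f : Lp ℝ 2 μ) x|) μ := hfi.const_mul _
  refine (integrable_and_integral_le_of_eventually_le (μ := μ)
    (h := fun x => (f : Lp ℝ 2 μ) x ^ 2)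
    (F := fun M x => 4 * (slice (R * m) (M + 1) ((f : Lp ℝ 2 μ) x) ^ 2 +
      slice (R * m) (M + 1) (-(f : Lp ℝ 2 μ) x) ^ 2) + 2 * (R * m) * |(f : Lp ℝ 2 μ) x|)
    (DirichletForm.integrable_sq f).aestronglyMeasurable (fun x => sq_nonneg _)
    (fun M => (hi1 M).add hi2) (fun M => Eventually.of_forall fun x => by
      simp only [Pi.zero_apply]
      positivity)
    (Eventually.of_forall fun x => ?_) fun M => ?_).2
  · filter_upwards [tendsto_natCast_atTop_atTop.eventually_ge_atTop
      (|(f : Lp ℝ 2 μ) x| - R * m)] with M hM'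
    exact sq_le_slice M (by linarith)
  · rw [integral_add (hi1 M) hi2, integral_const_mul, integral_const_mul,
      integral_add (hP M).1 (hMi M), ← integral_congr_ae (hMe M)]
    change _ + 2 * (R * m) * m ≤ _
    nlinarith [(hP M).2, (hM M).2]

lemma xi2_ne_bot_of_lt {β : ℝ → ℝ} {t r : ℝ} (hr : 0 < r) (h : β r < t) : xi2 β t ≠ ⊥ := by
  have hne : {y : ℝ | ∃ r : ℝ, 0 < r ∧ 0 < t - β r ∧ y = r / (t - β r)}.Nonempty :=
    ⟨_, r, hr, sub_pos.2 h, rfl⟩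
  rw [xi2, infBot_of_nonempty hne]
  exact EReal.coe_ne_bot _

lemma xi2_le_of_lt {β : ℝ → ℝ} {t r : ℝ} (hr : 0 < r) (h : β r < t) :
    xi2 β t ≤ ((r / (t - β r) : ℝ) : EReal) := by
  have hne : {y : ℝ | ∃ r : ℝ, 0 < r ∧ 0 < t - β r ∧ y = r / (t - β r)}.Nonempty :=
    ⟨_, r, hr, sub_pos.2 h, rfl⟩
  rw [xi2, infBot_of_nonempty hne, EReal.coe_le_coe_iff]
  refine csInf_le ⟨0, ?_⟩ ⟨r, hr, sub_pos.2 h, rfl⟩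
  rintro y ⟨r', hr', h', rfl⟩
  positivity

/-! ### Choice of constants and rate functions. -/

theorem SuperLogSobolev.exists_superPoincare {Ω : Type*} [MeasurableSpace Ω] {μ : Measure Ω}
    [IsProbabilityMeasure μ] {E : DirichletForm μ} (hE : E.Conservative) {β : ℝ → ℝ}
    (h : SuperLogSobolev E β) {δ : ℝ} (hδ : 1 < δ) :
    ∃ (C₅ C₆ : ℝ) (n₀ : ℕ), 0 < C₅ ∧ 0 < C₆ ∧ 2 ≤ n₀ ∧
      (∀ s : ℝ, 0 < s → (powerSet β δ C₆ n₀ s).Nonempty) ∧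
      SuperPoincare E (rateSP β δ C₅ C₆ n₀) := by
  have hL : 0 < Real.log δ := Real.log_pos hδ
  have hδ0 : 0 < δ := by linarith
  have htend : Tendsto (fun k : ℕ => (k : ℝ) * Real.log δ) atTop atTop :=
    tendsto_natCast_atTop_atTop.atTop_mul_const hL
  -- From `n₀` on, `r = 1` is admissible in `xi2 β (k log δ)`, so that no value is `⊥`.
  obtain ⟨n₀, hn₀⟩ := eventually_atTop.1
    ((htend.eventually_gt_atTop (β 1)).and (eventually_ge_atTop 2))
  have hne : ∀ s : ℝ, 0 < s → (powerSet β δ (1 / 8) n₀ s).Nonempty := by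
    intro s hs
    obtain ⟨k, hk, hk'⟩ := ((htend.eventually_ge_atTop (β 1 + 8 / s)).and
      (eventually_ge_atTop n₀)).exists
    refine ⟨δ ^ k, k, hk', (xi2_le_of_lt one_pos (hn₀ k hk').1).trans ?_, rfl⟩
    rw [EReal.coe_le_coe_iff, div_le_iff₀ (by linarith [(hn₀ k hk').1])]
    have h8 : 8 / s ≤ k * Real.log δ - β 1 := by linarith
    rw [div_le_iff₀ hs] at h8
    linarith
  have hnn : ∀ s, ∀ y ∈ powerSet β δ (1 / 8) n₀ s, 0 ≤ y := by
    rintro s y ⟨k, _, _, rfl⟩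
    positivity
  -- `2` and `1 / 8` offset the factors `2 R` and `8` of `integral_sq_le`.
  refine ⟨2, 1 / 8, n₀, two_pos, by norm_num, (hn₀ n₀ le_rfl).2, hne, ⟨?_, ?_⟩, ?_⟩
  · intro s hs s' _ hss
    refine mul_le_mul_of_nonneg_left (csInf_le_csInf ⟨0, hnn s'⟩ (hne s hs) ?_) two_pos.le
    rintro y ⟨k, hk, hξ, rfl⟩
    refine ⟨k, hk, hξ.trans ?_, rfl⟩
    rw [EReal.coe_le_coe_iff]
    gcongr
  · intro s _
    exact mul_nonneg two_pos.le (Real.sInf_nonneg (hnn s))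
  · intro s hs f
    have hb : ∀ y ∈ powerSet β δ (1 / 8) n₀ s, (∫ x, (f : Lp ℝ 2 μ) x ^ 2 ∂μ - s * E.form f f) / 2
        ≤ y * (∫ x, |(f : Lp ℝ 2 μ) x| ∂μ) ^ 2 := by
      rintro y ⟨k, hk, hξ, rfl⟩
      have e : Real.log (δ ^ k) = k * Real.log δ := Real.log_pow _ _
      have hbot : xi2 β (Real.log (δ ^ k)) ≠ ⊥ :=
        e ▸ xi2_ne_bot_of_lt one_pos (hn₀ k hk).1
      have h1 := h.integral_sq_le hE (pow_pos hδ0 k) hbot f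
      rw [← e] at hξ
      have h2 : (xi2 β (Real.log (δ ^ k))).toReal ≤ 1 / 8 * s := by
        have := EReal.toReal_le_toReal hξ hbot (EReal.coe_ne_top _)
        rwa [EReal.toReal_coe] at this
      nlinarith [E.nonneg f]
    have := le_sInf_mul (hne s hs) (sq_nonneg _) hb
    rw [rateSP]
    linarith

theorem SuperPoincare.exists_superLogSobolev {Ω : Type*} [MeasurableSpace Ω] {μ : Measure Ω}
    [IsProbabilityMeasure μ] {E : DirichletForm μ} (hE : E.Conservative) {β : ℝ → ℝ}
    (h : SuperPoincare E β) {δ : ℝ} (hδ : 1 < δ)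
    (hlim : Tendsto (fun n : ℕ => (n : EReal) * xi1 β (δ ^ (-(n : ℤ) + 1))) atTop (𝓝 0)) :
    ∃ (C₄ s₀ : ℝ) (n₀ : ℕ), 0 < C₄ ∧ 0 < s₀ ∧ 2 ≤ n₀ ∧
      (∀ s : ℝ, 0 < s → s ≤ s₀ → BddAbove (levelSet β δ C₄ n₀ s)) ∧
      SuperLogSobolev E (rateSL β δ C₄ s₀ n₀) := by
  have hδ0 : 0 < δ := by linarith
  set q := √δ
  have hq2 : q ^ 2 = δ := Real.sq_sqrt hδ0.le
  have hq : 1 < q := by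
    rw [← Real.sqrt_one]
    exact Real.sqrt_lt_sqrt zero_le_one hδ
  have hL : 0 < Real.log q := Real.log_pos hq
  have hLδ : Real.log δ = 2 * Real.log q := by rw [← hq2, Real.log_pow]; norm_num
  -- Twice the constant of `entropySq_le`, because `j + 2 ≤ 2 (j + 1)`.
  set C : ℝ := 8 * Real.log q * (q ^ 4 / (q - 1) ^ 2) with hC
  have hC0 : 0 < C := by
    have : 0 < q - 1 := by linarith
    positivity
  -- An empty infimum gives `n * ⊥ = ⊥` for `n > 0`, which a limit `0` excludes for large `n`.
  obtain ⟨n₀, hn₀⟩ := eventually_atTop.1 ((hlim.eventually_ne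
    (show (0 : EReal) ≠ ⊥ by simp)).and (eventually_ge_atTop 2))
  have hbot : ∀ n, n₀ ≤ n → xi1 β (δ ^ (-(n : ℤ) + 1)) ≠ ⊥ := by
    intro n hn hb
    refine (hn₀ n hn).1 ?_
    rw [hb]
    exact EReal.mul_bot_of_pos (by exact_mod_cast (show 0 < n by have := (hn₀ n hn).2; omega))
  have hcoe : ∀ n, n₀ ≤ n →
      xi1 β (δ ^ (-(n : ℤ) + 1)) = ((xi1 β (δ ^ (-(n : ℤ) + 1))).toReal : EReal) := by
    intro n hn
    rw [xi1, infBot_of_nonempty (nonempty_of_infBot_ne_bot (hbot n hn)), EReal.toReal_coe]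
  have hmem : ∀ n s, n ∈ levelSet β δ C n₀ s ↔
      n₀ ≤ n ∧ s < C * n * (xi1 β (δ ^ (-(n : ℤ) + 1))).toReal := by
    intro n s
    refine and_congr_right fun hn => ?_
    rw [hcoe n hn, ← EReal.coe_mul, EReal.coe_lt_coe_iff, EReal.toReal_coe]
  have hbdd : ∀ s : ℝ, 0 < s → BddAbove (levelSet β δ C n₀ s) := by
    intro s hs
    have h1 : (0 : EReal) < ((s / C : ℝ) : EReal) := by
      exact_mod_cast div_pos hs hC0
    obtain ⟨n₁, hn₁⟩ := eventually_atTop.1 (hlim.eventually_lt_const h1)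
    refine ⟨n₁, fun n hn => ?_⟩
    by_contra! hlt
    have h2 := hn₁ n hlt.le
    rw [hmem] at hn
    rw [hcoe n hn.1] at h2
    have h3 : (n : ℝ) * (xi1 β (δ ^ (-(n : ℤ) + 1))).toReal < s / C := by
      exact_mod_cast h2
    rw [lt_div_iff₀ hC0] at h3
    linarith [hn.2]
  have hbdd' : ∀ s : ℝ, 0 < s → BddAbove (insert n₀ (levelSet β δ C n₀ s)) :=
    fun s hs => (hbdd s hs).insert n₀
  have hanti : ∀ s s', 0 < s → s ≤ s' → bigN0 β δ C n₀ s' ≤ bigN0 β δ C n₀ s := by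
    intro s s' hs hss
    refine csSup_le_csSup (hbdd' s hs) (insert_nonempty _ _) (insert_subset_insert ?_)
    intro n hn
    rw [hmem] at hn ⊢
    exact ⟨hn.1, hss.trans_lt hn.2⟩
  have hrate : ∀ s, rateSL β δ C 1 n₀ s = 2 * Real.log q * (bigN0 β δ C n₀ (min s 1) + 1) := by
    intro s
    rw [rateSL, hLδ, add_comm (1 : ℝ), add_comm (1 : ℝ)]
    split_ifs with hs
    · rw [min_eq_left hs]
    · rw [min_eq_right (not_le.1 hs).le]
  -- The level sets are bounded for every `s > 0`, so `s₀ = 1` is an arbitrary choice.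
  refine ⟨C, 1, n₀, hC0, one_pos, (hn₀ n₀ le_rfl).2, fun s hs _ => hbdd s hs, ⟨?_, ?_⟩, ?_⟩
  · intro s hs s' _ hss
    rw [hrate, hrate]
    have := hanti (min s 1) (min s' 1) (lt_min hs one_pos) (min_le_min_right 1 hss)
    gcongr
  · intro s _
    rw [hrate]
    positivity
  · intro s hs f
    have hs1 : 0 < min s 1 := lt_min hs one_pos
    rw [hrate]
    have hN : ∀ j, bigN0 β δ C n₀ (min s 1) ≤ j → xi1 β ((q ^ (2 * j))⁻¹) ≠ ⊥ ∧
        4 * Real.log q * (j + 2) * (q ^ 4 / (q - 1) ^ 2) *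
          (xi1 β ((q ^ (2 * j))⁻¹)).toReal ≤ min s 1 := by
      intro j hj
      have hn₀N : n₀ ≤ bigN0 β δ C n₀ (min s 1) :=
        le_csSup (hbdd' _ hs1) (mem_insert _ _)
      -- Slice `j` corresponds to the index `n = j + 1`, which exceeds `N₀` as soon as `j ≥ N₀` and
      -- hence lies outside the level set.
      have e : (q ^ (2 * j))⁻¹ = δ ^ (-((j + 1 : ℕ) : ℤ) + 1) := by
        rw [pow_mul, hq2]
        simp
      rw [e]
      refine ⟨hbot _ (by omega), ?_⟩
      have hnot : j + 1 ∉ levelSet β δ C n₀ (min s 1) := by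
        intro hmem'
        have : j + 1 ≤ bigN0 β δ C n₀ (min s 1) :=
          le_csSup (hbdd' _ hs1) (mem_insert_of_mem _ hmem')
        omega
      rw [hmem, not_and, not_lt] at hnot
      have h1 := hnot (by omega)
      have hξ : 0 ≤ (xi1 β (δ ^ (-((j + 1 : ℕ) : ℤ) + 1))).toReal := by
        rw [xi1, infBot_of_nonempty (nonempty_of_infBot_ne_bot (hbot _ (by omega))),
          EReal.toReal_coe]
        refine Real.sInf_nonneg ?_
        rintro y ⟨r, hr, hr1, rfl⟩
        positivity
      refine le_trans ?_ h1
      rw [hC]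
      have h2 : 4 * Real.log q * (j + 2) * (q ^ 4 / (q - 1) ^ 2) ≤
          8 * Real.log q * (q ^ 4 / (q - 1) ^ 2) * ((j + 1 : ℕ) : ℝ) := by
        have h3 : 0 ≤ 4 * Real.log q * (q ^ 4 / (q - 1) ^ 2) * j := by positivity
        push_cast
        linarith
      gcongr
    obtain ⟨hi, hle⟩ := h.entropySq_le hE hq hs1.le hN f
    refine ⟨hi, hle.trans ?_⟩
    gcongr
    · exact E.nonneg f
    · exact min_le_left _ _
theorem theorem1p2 {Ω : Type*} [MeasurableSpace Ω] (μ : Measure Ω) [IsProbabilityMeasure μ]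
    (E : DirichletForm μ) (hE : E.Conservative) :
    (∀ βSP : ℝ → ℝ, SuperPoincare E βSP → ∀ δ : ℝ, 2 < δ →
      Tendsto (fun n : ℕ => (n : EReal) * xi1 βSP (δ ^ (-(n : ℤ) + 1))) atTop (𝓝 0) →
      ∃ (C₄ s₀ : ℝ) (n₀ : ℕ), 0 < C₄ ∧ 0 < s₀ ∧ 2 ≤ n₀ ∧
        (∀ s : ℝ, 0 < s → s ≤ s₀ → BddAbove (levelSet βSP δ C₄ n₀ s)) ∧
        SuperLogSobolev E (rateSL βSP δ C₄ s₀ n₀)) ∧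
    (∀ βSL : ℝ → ℝ, SuperLogSobolev E βSL → ∀ δ : ℝ, 2 < δ →
      ∃ (C₅ C₆ : ℝ) (n₀ : ℕ), 0 < C₅ ∧ 0 < C₆ ∧ 2 ≤ n₀ ∧
        (∀ s : ℝ, 0 < s → (powerSet βSL δ C₆ n₀ s).Nonempty) ∧
        SuperPoincare E (rateSP βSL δ C₅ C₆ n₀)) := by
  exact ⟨fun _ h _ hδ hlim => h.exists_superLogSobolev hE (by linarith) hlim,
    fun _ h _ hδ => h.exists_superPoincare hE (by linarith)⟩
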